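/- Let $\mathbb{k}$ be a field, let $S=\mathbb{k}[x_1,\dots,x_n]$ and $S'=\mathbb{k}[y_1,\dots,y_m]$ be polynomial rings with their fine multigradings, and let $I\subsetneq S$ and $I'\subsetneq S'$ be proper monomial ideals, with $I$ squarefree, i.e. generated by squarefree monomials. The *lcm lattice* $L_I$ of $I$ is the set of all least common multiples of subsets of the set of minimal monomial generators of $I$ (including $1=\operatorname{lcm}(\emptyset)$), ordered by divisibility. Let $\mathbb{F}:\ \cdots\to\mathbb{F}_2\to\mathbb{F}_1\to\mathbb{F}_0=S$ with differential $\partial$ be the multigraded minimal free resolution of $S/I$, regarded also as the module $\mathbb{F}=\bigoplus_i\mathbb{F}_i$; write $|a|=i$ for $a\in\mathbb{F}_i$. We say that $I$ *admits a minimal DGA resolution* if there is an $S$-linear map $*:\mathbb{F}\otimes_S\mathbb{F}\to\mathbb{F}$ that respects the multigrading and satisfies, for all $a,b,c\in\mathbb{F}$ (homogeneous with respect to the homological degree where $|\cdot|$ is used): 1. $*$ extends the multiplication of $\mathbb{F}_0=S$, and $1\in\mathbb{F}_0$ is its unit; 2. $\partial(a*b)=\partial(a)*b+(-1)^{|a|}a*\partial(b)$;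 3. $|a*b|=|a|+|b|$; 4. $a*b=(-1)^{|a|\cdot|b|}\,b*a$; 5. $(a*b)*c=a*(b*c)$. The same definitions apply to $I'$ and $S'$. **Corollary 6.7.** If the lattices $L_I$ and $L_{I'}$ are isomorphic and $I$ admits a minimal DGA resolution, then so does $I'$. -/

import Mathlib

open MvPolynomial

noncomputable section

namespace MonomialDGA

/-! ### Monomial ideals and their lcm lattices

A monomial `x^a` of `S = k[x_i : i ∈ σ]` is represented by its exponent vector `a : σ →₀ ℕ`. Under
this identification divisibility is the componentwise order and the lcm is the supremum. -/

section LcmLattice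

variable {k σ : Type*} [Field k]

/-- `I` is a monomial ideal: it is generated by a set of monomials. -/
def IsMonomialIdeal (I : Ideal (MvPolynomial σ k)) : Prop :=
  ∃ A : Set (σ →₀ ℕ), I = Ideal.span ((fun a => monomial a (1 : k)) '' A)

/-- `I` is a squarefree monomial ideal: it is generated by a set of squarefree monomials. -/
def IsSquarefreeMonomialIdeal (I : Ideal (MvPolynomial σ k)) : Prop :=
  ∃ A : Set (σ →₀ ℕ), (∀ a ∈ A, ∀ i, a i ≤ 1) ∧
    I = Ideal.span ((fun a => monomial a (1 : k)) '' A)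

/-- The minimal monomial generators `G(I)` of a monomial ideal `I`: the monomials in `I` that are
minimal with respect to divisibility. -/
def minimalGenerators (I : Ideal (MvPolynomial σ k)) : Set (σ →₀ ℕ) :=
  {a | Minimal (fun b => monomial b (1 : k) ∈ I) a}

/-- The lcm lattice `L_I`: all least common multiples of (finite) sets of minimal generators of `I`,
ordered by divisibility. The empty set contributes its bottom element `1 = x^0`. -/
def lcmLattice (I : Ideal (MvPolynomial σ k)) : Set (σ →₀ ℕ) :=
  {m | ∃ W : Finset (σ →₀ ℕ), ↑W ⊆ minimalGenerators I ∧ m = W.sup id}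

/-- `L_I` and `L_{I'}` are isomorphic. (An order isomorphism between lattices is the same thing as a
lattice isomorphism.) -/
def LcmLatticeIsomorphic {τ : Type*} (I : Ideal (MvPolynomial σ k))
    (I' : Ideal (MvPolynomial τ k)) : Prop :=
  Nonempty (lcmLattice I ≃o lcmLattice I')

end LcmLattice

/-! ### Multigraded minimal free resolutions -/

section Resolution

variable {k σ B : Type*} [Field k]

/-- For the free module `F = ⨁_{b ∈ B} S` whose basis element `b` has homological degree `hdeg b`:
the summand `F_i` of homological degree `i`. -/
def homologicalPart (k σ : Type*) [Field k] {B : Type*} (hdeg : B → ℕ) (i : ℕ) :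
    Submodule (MvPolynomial σ k) (B →₀ MvPolynomial σ k) :=
  Finsupp.supported (MvPolynomial σ k) (MvPolynomial σ k) {b | hdeg b = i}

/-- For the free module `F = ⨁_{b ∈ B} S(-mdeg b)` whose basis element `b` has multidegree `mdeg b`:
`f` is homogeneous of multidegree `a`, that is, each monomial `x^c` occurring in the `b`-coordinate
of `f` satisfies `c + mdeg b = a`. -/
def HasMultidegree (mdeg : B → σ →₀ ℕ) (f : B →₀ MvPolynomial σ k) (a : σ →₀ ℕ) : Prop :=
  ∀ b, ∀ c ∈ (f b).support, c + mdeg b = a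

end Resolution

/-- A multigraded minimal free resolution
`⋯ → F_2 → F_1 → F_0 = S → S/I → 0` of `S/I`, for `S = k[x_i : i ∈ σ]` and `I` a proper ideal.
The complex is recorded as the single free module `F = ⨁_i F_i = (B →₀ S)` on a basis `B` that is
homogeneous with respect to the homological degree and the multidegree. (As `S/I` lives in
multidegrees in `ℕ^n`, so do the generators of its minimal free resolution.) -/
structure MinimalFreeResolution {k σ : Type*} [Field k] (I : Ideal (MvPolynomial σ k)) where
  /-- the homogeneous basis of `F` -/
  B : Type
  /-- the homological degrees of the basis elements -/
  hdeg : B → ℕ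
  /-- the multidegrees of the basis elements -/
  mdeg : B → σ →₀ ℕ
  /-- each `F_i` is finitely generated -/
  finite_rank : ∀ i, {b | hdeg b = i}.Finite
  /-- the basis element `1` of `F_0 = S` -/
  root : B
  /-- `F_0 = S`: the element `root` is the only basis element of homological degree `0` -/
  hdeg_eq_zero_iff : ∀ b, hdeg b = 0 ↔ b = root
  /-- `F_0 = S` as graded modules: `1` has multidegree `0` -/
  mdeg_root : mdeg root = 0
  /-- the differential -/
  d : (B →₀ MvPolynomial σ k) →ₗ[MvPolynomial σ k] (B →₀ MvPolynomial σ k)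
  /-- the differential maps `F_{i+1}` to `F_i` -/
  d_mem : ∀ i, ∀ f ∈ homologicalPart k σ hdeg (i + 1), d f ∈ homologicalPart k σ hdeg i
  /-- the differential vanishes on `F_0` -/
  d_zero : ∀ f ∈ homologicalPart k σ hdeg 0, d f = 0
  /-- the differential respects the multigrading -/
  d_multidegree : ∀ f a, HasMultidegree mdeg f a → HasMultidegree mdeg (d f) a
  /-- `∂ ∘ ∂ = 0` -/
  d_comp_d : ∀ f, d (d f) = 0
  /-- exactness at `F_{i+1}` -/
  exact : ∀ i, ∀ f ∈ homologicalPart k σ hdeg (i + 1), d f = 0 →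
    ∃ g ∈ homologicalPart k σ hdeg (i + 2), d g = f
  /-- exactness of `F_1 → F_0 = S → S/I → 0`: the image of `F_1` in `S` is `I` -/
  augmentation : ∀ s : MvPolynomial σ k,
    (∃ f ∈ homologicalPart k σ hdeg 1, d f = Finsupp.single root s) ↔ s ∈ I
  /-- minimality: `∂ F ⊆ 𝔪 F`, where `𝔪` is the ideal generated by the variables -/
  minimal : LinearMap.range d ≤
    idealOfVars σ k • (⊤ : Submodule (MvPolynomial σ k) (B →₀ MvPolynomial σ k))

/-- The `S`-bilinear map `mul` (equivalently, `S`-linear map `F ⊗ F → F`) is a differential graded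
algebra structure on `F` that respects the multigrading. -/
structure MinimalFreeResolution.IsDGA {k σ : Type*} [Field k] {I : Ideal (MvPolynomial σ k)}
    (F : MinimalFreeResolution I)
    (mul : (F.B →₀ MvPolynomial σ k) →ₗ[MvPolynomial σ k]
      (F.B →₀ MvPolynomial σ k) →ₗ[MvPolynomial σ k] (F.B →₀ MvPolynomial σ k)) : Prop where
  /-- `mul` extends the multiplication of `F_0 = S`, whose `1` is the unit of the algebra `F` -/
  one_mul : ∀ f, mul (Finsupp.single F.root 1) f = f
  /-- Leibniz rule -/
  leibniz : ∀ i, ∀ f ∈ homologicalPart k σ F.hdeg i, ∀ g,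
    F.d (mul f g) = mul (F.d f) g + (-1 : MvPolynomial σ k) ^ i • mul f (F.d g)
  /-- homogeneity with respect to the homological degree -/
  mul_mem : ∀ i j, ∀ f ∈ homologicalPart k σ F.hdeg i, ∀ g ∈ homologicalPart k σ F.hdeg j,
    mul f g ∈ homologicalPart k σ F.hdeg (i + j)
  /-- homogeneity with respect to the multidegree -/
  mul_multidegree : ∀ f g a b, HasMultidegree F.mdeg f a → HasMultidegree F.mdeg g b →
    HasMultidegree F.mdeg (mul f g) (a + b)
  /-- graded commutativity -/
  mul_comm : ∀ i j, ∀ f ∈ homologicalPart k σ F.hdeg i, ∀ g ∈ homologicalPart k σ F.hdeg j,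
    mul f g = (-1 : MvPolynomial σ k) ^ (i * j) • mul g f
  /-- associativity -/
  mul_assoc : ∀ f g h, mul (mul f g) h = mul f (mul g h)

/-- `I` admits a minimal DGA resolution: the minimal free resolution of `S/I` (which is unique up to
isomorphism) carries a multigraded DGA structure. -/
def AdmitsMinimalDGAResolution {k σ : Type*} [Field k] (I : Ideal (MvPolynomial σ k)) : Prop :=
  ∃ F : MinimalFreeResolution I, ∃ mul, F.IsDGA mul

end MonomialDGA

end

/-! A multigraded map between free modules with homogeneous bases is determined by its scalar
coefficients (set all variables to `1`), and a scalar map arises this way exactly when it does not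
raise multidegrees. So a multigraded resolution is a complex of `k`-vector spaces filtered by
multidegree, and exactness in multidegree `m` concerns only the basis elements `b` with `mdeg b ≤
m`.

For a minimal resolution of `S/I` all `mdeg b` lie in the lcm lattice (`mdeg_mem_lcmLattice`). An
isomorphism `e` of lcm lattices therefore gives new multidegrees `e (mdeg b)` for the same scalars.
If `n` is the greatest element of the lattice of `I'` below `m`, the new strand at `m` is the old
strand at `e.symm n`, so the relabeled complex is again a minimal resolution
(`isRelabeling_of_orderIso`, `relabel`).

A product is graded when every `c` occurring in `a * b` satisfies `mdeg c ≤ mdeg a + mdeg b`. Sums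
are not lattice operations, but for squarefree `I` this bound improves to `mdeg c ≤ mdeg a ⊔ mdeg b`
(`le_sup_of_le_add`), which `e` preserves, and a join is at most the sum. The DGA axioms then carry
over because they are identities between scalars (`IsDGA.relabel`). -/

noncomputable section

namespace MonomialDGA

/-! ### Multigraded strands and dehomogenization -/

section Strands

variable {k σ B : Type*} [Field k]

/-- Set all variables to `1`. -/
def dehom : (B →₀ MvPolynomial σ k) →ₗ[k] (B →₀ k) :=
  Finsupp.mapRange.linearMap (aeval (fun _ => (1 : k))).toLinearMap

@[simp]
lemma dehom_apply (f : B →₀ MvPolynomial σ k) (b : B) :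
    dehom f b = aeval (fun _ => (1 : k)) (f b) := rfl

lemma dehom_smul (p : MvPolynomial σ k) (f : B →₀ MvPolynomial σ k) :
    dehom (p • f) = aeval (fun _ => (1 : k)) p • dehom f := by
  ext b
  simp

lemma dehom_single (b : B) (p : MvPolynomial σ k) :
    dehom (Finsupp.single b p) = Finsupp.single b (aeval (fun _ => (1 : k)) p) := by
  simp [dehom]

lemma aeval_one_monomial (c : σ →₀ ℕ) (r : k) :
    aeval (fun _ => (1 : k)) (monomial c r) = r := by
  simp [aeval_monomial]

/-- The homogenization of `v` in multidegree `m`. -/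
def homog (mdeg : B → σ →₀ ℕ) (m : σ →₀ ℕ) (v : B →₀ k) : B →₀ MvPolynomial σ k :=
  Finsupp.onFinset v.support (fun b => monomial (m - mdeg b) (v b)) (by
    intro b hb
    rw [Finsupp.mem_support_iff]
    rintro h
    simp [h] at hb)

@[simp]
lemma homog_apply (mdeg : B → σ →₀ ℕ) (m : σ →₀ ℕ) (v : B →₀ k) (b : B) :
    homog mdeg m v b = monomial (m - mdeg b) (v b) := rfl

/-- `v` is supported on basis elements whose multidegree is at most `m`. -/
def BoundedBy (mdeg : B → σ →₀ ℕ) (m : σ →₀ ℕ) (v : B →₀ k) : Prop :=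
  ∀ b, v b ≠ 0 → mdeg b ≤ m

/-- The scalar vector given by the component of `f` of multidegree `a`. -/
def strand (mdeg : B → σ →₀ ℕ) (a : σ →₀ ℕ) : (B →₀ MvPolynomial σ k) →ₗ[k] (B →₀ k) where
  -- Multiplying by `x^(mdeg b)`, rather than reading the coefficient at the truncated `a - mdeg b`,
  -- makes the entry vanish unless `mdeg b ≤ a`.
  toFun f := Finsupp.onFinset f.support (fun b => coeff a (monomial (mdeg b) 1 * f b)) (by
    intro b hb
    rw [Finsupp.mem_support_iff]
    rintro h
    simp [h] at hb)
  map_add' f g := by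
    ext b
    simp [mul_add]
  map_smul' r f := by
    ext b
    simp

lemma strand_apply (mdeg : B → σ →₀ ℕ) (a : σ →₀ ℕ) (f : B →₀ MvPolynomial σ k) (b : B) :
    strand mdeg a f b = coeff a (monomial (mdeg b) 1 * f b) := rfl

lemma strand_apply_add (mdeg : B → σ →₀ ℕ) (c : σ →₀ ℕ) (f : B →₀ MvPolynomial σ k) (b : B) :
    strand mdeg (mdeg b + c) f b = coeff c (f b) := by
  simp [strand_apply, coeff_monomial_mul]

lemma strand_ext {mdeg : B → σ →₀ ℕ} {f g : B →₀ MvPolynomial σ k}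
    (h : ∀ a, strand mdeg a f = strand mdeg a g) : f = g := by
  ext b c
  rw [← strand_apply_add mdeg, h, strand_apply_add]

lemma boundedBy_strand (mdeg : B → σ →₀ ℕ) (a : σ →₀ ℕ) (f : B →₀ MvPolynomial σ k) :
    BoundedBy mdeg a (strand mdeg a f) := by
  classical
  intro b hb
  by_contra h
  exact hb (by simp [strand_apply, coeff_monomial_mul', h])

/-- The bound rules out truncation in the exponents `m - mdeg b`; without it `homog` need not be
homogeneous. -/
lemma strand_homog [DecidableEq σ] (mdeg : B → σ →₀ ℕ) (a m : σ →₀ ℕ) {v : B →₀ k}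
    (hv : BoundedBy mdeg m v) :
    strand mdeg a (homog mdeg m v) = if a = m then v else 0 := by
  ext b
  by_cases hb : v b = 0
  · split_ifs <;> simp [strand_apply, hb]
  · rw [strand_apply, homog_apply, monomial_mul, coeff_monomial, add_tsub_cancel_of_le (hv b hb)]
    by_cases h : a = m
    · simp [h]
    · rw [if_neg h, if_neg (Ne.symm h)]
      rfl

lemma strand_monomial_smul (mdeg : B → σ →₀ ℕ) (a c : σ →₀ ℕ) (r : k)
    (f : B →₀ MvPolynomial σ k) :
    strand mdeg a (monomial c r • f) = if c ≤ a then r • strand mdeg (a - c) f else 0 := by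
  classical
  ext b
  rw [strand_apply, Finsupp.smul_apply, smul_eq_mul, mul_left_comm, coeff_monomial_mul']
  split_ifs <;> simp [strand_apply]

lemma strand_single (mdeg : B → σ →₀ ℕ) (a : σ →₀ ℕ) (b : B) (p : MvPolynomial σ k) :
    strand mdeg a (Finsupp.single b p) = Finsupp.single b (coeff a (monomial (mdeg b) 1 * p)) := by
  classical
  ext b'
  by_cases h : b = b'
  · subst h
    simp [strand_apply]
  · simp [strand_apply, h]

lemma exists_finset_strand_eq_zero (mdeg : B → σ →₀ ℕ) (f : B →₀ MvPolynomial σ k) :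
    ∃ A : Finset (σ →₀ ℕ), ∀ a ∉ A, strand mdeg a f = 0 := by
  classical
  refine ⟨f.support.biUnion fun b => (monomial (mdeg b) 1 * f b).support, fun a ha => ?_⟩
  ext b
  by_contra hb
  refine ha (Finset.mem_biUnion.2 ⟨b, ?_, mem_support_iff.2 hb⟩)
  rw [Finsupp.mem_support_iff]
  intro h
  exact hb (by simp [strand_apply, h])

lemma induction_monomial_smul_single {P : (B →₀ MvPolynomial σ k) → Prop}
    (h0 : P 0) (hadd : ∀ f g, P f → P g → P (f + g))
    (hs : ∀ b (c : σ →₀ ℕ) (r : k), P (monomial c r • Finsupp.single b 1)) (f) : P f := by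
  induction f using Finsupp.induction_linear with
  | zero => exact h0
  | add f g hf hg => exact hadd f g hf hg
  | single b p =>
    induction p using MvPolynomial.induction_on' with
    | monomial c r => simpa using hs b c r
    | add p q hp hq =>
      rw [Finsupp.single_add]
      exact hadd _ _ hp hq

/-! ### Multihomogeneous elements -/

section

variable {mdeg : B → σ →₀ ℕ}

lemma hasMultidegree_iff {f : B →₀ MvPolynomial σ k} {a : σ →₀ ℕ} :
    HasMultidegree mdeg f a ↔ ∀ b c, coeff c (f b) ≠ 0 → c + mdeg b = a := by
  simp [HasMultidegree]

lemma hasMultidegree_zero (a : σ →₀ ℕ) :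
    HasMultidegree mdeg (0 : B →₀ MvPolynomial σ k) a := by
  simp [hasMultidegree_iff]

lemma HasMultidegree.add {f g : B →₀ MvPolynomial σ k} {a : σ →₀ ℕ}
    (hf : HasMultidegree mdeg f a) (hg : HasMultidegree mdeg g a) :
    HasMultidegree mdeg (f + g) a := by
  rw [hasMultidegree_iff] at *
  intro b c h
  by_cases h1 : coeff c (f b) = 0
  · exact hg b c (by simpa [h1] using h)
  · exact hf b c h1

lemma HasMultidegree.neg {f : B →₀ MvPolynomial σ k} {a : σ →₀ ℕ}
    (hf : HasMultidegree mdeg f a) : HasMultidegree mdeg (-f) a := by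
  rw [hasMultidegree_iff] at *
  intro b c h
  exact hf b c (by simpa using h)

lemma HasMultidegree.neg_one_pow_smul {f : B →₀ MvPolynomial σ k} {a : σ →₀ ℕ}
    (hf : HasMultidegree mdeg f a) (i : ℕ) :
    HasMultidegree mdeg ((-1 : MvPolynomial σ k) ^ i • f) a := by
  rcases neg_one_pow_eq_or (MvPolynomial σ k) i with h | h
  · simpa [h] using hf
  · simpa [h] using hf.neg

lemma HasMultidegree.monomial_smul {f : B →₀ MvPolynomial σ k} {a : σ →₀ ℕ}
    (hf : HasMultidegree mdeg f a) (c : σ →₀ ℕ) (r : k) :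
    HasMultidegree mdeg (monomial c r • f) (c + a) := by
  classical
  rw [hasMultidegree_iff] at *
  intro b e h
  rw [Finsupp.smul_apply, smul_eq_mul, coeff_monomial_mul'] at h
  split_ifs at h with hc
  · rw [← hf b (e - c) (right_ne_zero_of_mul h), ← add_assoc, add_tsub_cancel_of_le hc]
  · exact absurd rfl h

lemma hasMultidegree_single (b : B) :
    HasMultidegree mdeg (Finsupp.single b (1 : MvPolynomial σ k)) (mdeg b) := by
  classical
  rw [hasMultidegree_iff]
  intro b' c h
  by_cases hb : b = b'
  · subst hb
    rw [Finsupp.single_eq_same, coeff_one] at h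
    have : 0 = c := by
      by_contra h'
      simp [h'] at h
    simp [← this]
  · simp [hb] at h

lemma hasMultidegree_homog {m : σ →₀ ℕ} {v : B →₀ k} (hv : BoundedBy mdeg m v) :
    HasMultidegree mdeg (homog mdeg m v) m := by
  classical
  rw [hasMultidegree_iff]
  intro b c h
  rw [homog_apply, coeff_monomial] at h
  split_ifs at h with hc
  · rw [← hc, tsub_add_cancel_of_le (hv b h)]
  · exact absurd rfl h

lemma HasMultidegree.apply_eq_monomial {f : B →₀ MvPolynomial σ k} {a : σ →₀ ℕ}
    (hf : HasMultidegree mdeg f a) (b : B) :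
    f b = monomial (a - mdeg b) (coeff (a - mdeg b) (f b)) := by
  classical
  rw [hasMultidegree_iff] at hf
  ext c
  rw [coeff_monomial]
  split_ifs with h
  · rw [h]
  · by_contra hc
    exact h (by rw [← hf b c hc, add_tsub_cancel_right])

lemma HasMultidegree.homog_dehom {f : B →₀ MvPolynomial σ k} {a : σ →₀ ℕ}
    (hf : HasMultidegree mdeg f a) : homog mdeg a (dehom f) = f := by
  refine Finsupp.ext fun b => ?_
  rw [homog_apply, dehom_apply, hf.apply_eq_monomial b, aeval_one_monomial]

lemma HasMultidegree.boundedBy_dehom {f : B →₀ MvPolynomial σ k} {a : σ →₀ ℕ}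
    (hf : HasMultidegree mdeg f a) : BoundedBy mdeg a (dehom f) := by
  intro b hb
  rw [dehom_apply, hf.apply_eq_monomial b, aeval_one_monomial] at hb
  rw [← hasMultidegree_iff.1 hf b _ hb]
  exact le_add_self

/-- The transfer principle: once the multidegree is known, the exponents are forced and only the
scalars remain to be compared. -/
lemma HasMultidegree.ext_dehom {f g : B →₀ MvPolynomial σ k} {a : σ →₀ ℕ}
    (hf : HasMultidegree mdeg f a) (hg : HasMultidegree mdeg g a) (h : dehom f = dehom g) :
    f = g := by
  rw [← hf.homog_dehom, h, hg.homog_dehom]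

lemma dehom_homog (m : σ →₀ ℕ) (v : B →₀ k) : dehom (homog mdeg m v) = v := by
  ext b
  rw [dehom_apply, homog_apply, aeval_one_monomial]

lemma HasMultidegree.induction {a : σ →₀ ℕ} {P : (B →₀ MvPolynomial σ k) → Prop}
    (h0 : P 0) (hadd : ∀ f g, P f → P g → P (f + g))
    (hs : ∀ b c (r : k), c + mdeg b = a → P (monomial c r • Finsupp.single b 1))
    {f} (hf : HasMultidegree mdeg f a) : P f := by
  rw [← Finsupp.sum_single f, Finsupp.sum]
  refine Finset.sum_induction _ P hadd h0 fun b hb => ?_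
  rw [hf.apply_eq_monomial b]
  by_cases hr : coeff (a - mdeg b) (f b) = 0
  · rw [hr]
    simpa using h0
  · have := hs b _ (coeff (a - mdeg b) (f b)) (hasMultidegree_iff.1 hf b _ hr)
    simpa using this

/-! ### Homogenization of linear maps -/

/-- The scalar linear map obtained from a linear map by setting all variables to `1`. -/
def scalarize (G : (B →₀ MvPolynomial σ k) →ₗ[MvPolynomial σ k] (B →₀ MvPolynomial σ k)) :
    (B →₀ k) →ₗ[k] (B →₀ k) :=
  Finsupp.linearCombination k fun b => dehom (G (Finsupp.single b 1))

lemma scalarize_single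
    (G : (B →₀ MvPolynomial σ k) →ₗ[MvPolynomial σ k] (B →₀ MvPolynomial σ k)) (b : B) :
    scalarize G (Finsupp.single b 1) = dehom (G (Finsupp.single b 1)) := by
  simp [scalarize]

lemma dehom_map (G : (B →₀ MvPolynomial σ k) →ₗ[MvPolynomial σ k] (B →₀ MvPolynomial σ k)) (f) :
    dehom (G f) = scalarize G (dehom f) := by
  induction f using induction_monomial_smul_single with
  | h0 => simp
  | hadd f g hf hg => simp [hf, hg]
  | hs b c r =>
    rw [map_smul, dehom_smul, dehom_smul, map_smul, dehom_single, map_one, scalarize_single]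

variable (mdeg) in
/-- The multigraded linear map with the scalar coefficients of `T`. -/
def homogenize (T : (B →₀ k) →ₗ[k] (B →₀ k)) :
    (B →₀ MvPolynomial σ k) →ₗ[MvPolynomial σ k] (B →₀ MvPolynomial σ k) :=
  Finsupp.linearCombination _ fun b => homog mdeg (mdeg b) (T (Finsupp.single b 1))

lemma homogenize_single (T : (B →₀ k) →ₗ[k] (B →₀ k)) (b : B) :
    homogenize (σ := σ) mdeg T (Finsupp.single b 1) =
      homog mdeg (mdeg b) (T (Finsupp.single b 1)) := by
  simp [homogenize]

variable (mdeg) in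
/-- `T` does not raise multidegrees. -/
def Filtered (T : (B →₀ k) →ₗ[k] (B →₀ k)) : Prop :=
  ∀ b, BoundedBy mdeg (mdeg b) (T (Finsupp.single b 1))

lemma scalarize_homogenize (T : (B →₀ k) →ₗ[k] (B →₀ k)) :
    scalarize (homogenize (σ := σ) mdeg T) = T := by
  refine Finsupp.lhom_ext' fun b => LinearMap.ext_ring ?_
  simp only [LinearMap.comp_apply, Finsupp.lsingle_apply]
  rw [scalarize_single, homogenize_single, dehom_homog]

lemma dehom_homogenize (T : (B →₀ k) →ₗ[k] (B →₀ k)) (f : B →₀ MvPolynomial σ k) :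
    dehom (homogenize mdeg T f) = T (dehom f) := by
  rw [dehom_map, scalarize_homogenize]

lemma filtered_scalarize
    {G : (B →₀ MvPolynomial σ k) →ₗ[MvPolynomial σ k] (B →₀ MvPolynomial σ k)}
    (hG : ∀ f a, HasMultidegree mdeg f a → HasMultidegree mdeg (G f) a) :
    Filtered mdeg (scalarize G) := by
  intro b
  rw [scalarize_single]
  exact (hG _ _ (hasMultidegree_single b)).boundedBy_dehom

lemma homogenize_scalarize
    {G : (B →₀ MvPolynomial σ k) →ₗ[MvPolynomial σ k] (B →₀ MvPolynomial σ k)}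
    (hG : ∀ f a, HasMultidegree mdeg f a → HasMultidegree mdeg (G f) a) :
    homogenize mdeg (scalarize G) = G := by
  refine Finsupp.lhom_ext' fun b => LinearMap.ext_ring ?_
  simp only [LinearMap.comp_apply, Finsupp.lsingle_apply]
  rw [homogenize_single, scalarize_single, (hG _ _ (hasMultidegree_single b)).homog_dehom]

lemma HasMultidegree.homogenize {T : (B →₀ k) →ₗ[k] (B →₀ k)} (hT : Filtered mdeg T)
    {f : B →₀ MvPolynomial σ k} {a : σ →₀ ℕ} (hf : HasMultidegree mdeg f a) :
    HasMultidegree mdeg (homogenize mdeg T f) a := by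
  refine HasMultidegree.induction
    (P := fun f => HasMultidegree mdeg (MonomialDGA.homogenize mdeg T f) a) ?_ ?_ ?_ hf
  · rw [map_zero]
    exact hasMultidegree_zero a
  · intro f g hf hg
    rw [map_add]
    exact hf.add hg
  · rintro b c r rfl
    rw [map_smul, homogenize_single]
    exact (hasMultidegree_homog (hT b)).monomial_smul c r

/-- Every strand of a homogenized map is the same scalar map `T`, so kernels and images can be
computed strand by strand. -/
lemma strand_homogenize {T : (B →₀ k) →ₗ[k] (B →₀ k)} (hT : Filtered mdeg T) (a : σ →₀ ℕ)
    (f : B →₀ MvPolynomial σ k) :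
    strand mdeg a (homogenize mdeg T f) = T (strand mdeg a f) := by
  classical
  induction f using induction_monomial_smul_single with
  | h0 => simp
  | hadd f g hf hg => simp [hf, hg]
  | hs b c r =>
    rw [map_smul, homogenize_single, strand_monomial_smul, strand_monomial_smul,
      strand_homog mdeg _ _ (hT b), strand_single, mul_one, coeff_monomial]
    by_cases h : c ≤ a
    · by_cases h' : a - c = mdeg b
      · simp only [h, h', if_true, map_smul]
      · simp only [h, h', Ne.symm h', if_true, if_false, map_smul, Finsupp.single_zero, map_zero]
    · simp [h]

/-! ### Homological degrees -/

variable {hdeg : B → ℕ}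

lemma mem_homologicalPart {f : B →₀ MvPolynomial σ k} {i : ℕ} :
    f ∈ homologicalPart k σ hdeg i ↔ ∀ b, f b ≠ 0 → hdeg b = i := by
  rw [homologicalPart, Finsupp.mem_supported']
  exact forall_congr' fun b => not_imp_comm

variable (hdeg) in
/-- The scalar vectors supported in homological degree `i`. -/
def scalarPart (k : Type*) [Field k] (i : ℕ) : Submodule k (B →₀ k) :=
  Finsupp.supported k k {b | hdeg b = i}

lemma mem_scalarPart {v : B →₀ k} {i : ℕ} :
    v ∈ scalarPart hdeg k i ↔ ∀ b, v b ≠ 0 → hdeg b = i := by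
  rw [scalarPart, Finsupp.mem_supported']
  exact forall_congr' fun b => not_imp_comm

lemma single_mem_scalarPart (b : B) (r : k) : Finsupp.single b r ∈ scalarPart hdeg k (hdeg b) :=
  Finsupp.single_mem_supported k r rfl

lemma single_mem_homologicalPart (b : B) (p : MvPolynomial σ k) :
    Finsupp.single b p ∈ homologicalPart k σ hdeg (hdeg b) :=
  Finsupp.single_mem_supported _ p rfl

lemma dehom_mem_scalarPart {f : B →₀ MvPolynomial σ k} {i : ℕ}
    (hf : f ∈ homologicalPart k σ hdeg i) : dehom f ∈ scalarPart hdeg k i := by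
  rw [mem_homologicalPart] at hf
  rw [mem_scalarPart]
  exact fun b hb => hf b fun h => hb (by simp [h])

lemma strand_mem_scalarPart {f : B →₀ MvPolynomial σ k} {i : ℕ}
    (hf : f ∈ homologicalPart k σ hdeg i) (a : σ →₀ ℕ) :
    strand mdeg a f ∈ scalarPart hdeg k i := by
  rw [mem_homologicalPart] at hf
  rw [mem_scalarPart]
  exact fun b hb => hf b fun h => hb (by simp [strand_apply, h])

lemma homog_mem_homologicalPart {v : B →₀ k} {i : ℕ} (hv : v ∈ scalarPart hdeg k i)
    (a : σ →₀ ℕ) : homog mdeg a v ∈ homologicalPart k σ hdeg i := by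
  rw [mem_scalarPart] at hv
  rw [mem_homologicalPart]
  exact fun b hb => hv b fun h => hb (by simp [h])

lemma homologicalPart_induction {i : ℕ} {P : (B →₀ MvPolynomial σ k) → Prop}
    (h0 : P 0) (hadd : ∀ f g, P f → P g → P (f + g)) (hsmul : ∀ (p : MvPolynomial σ k) f,
      P f → P (p • f)) (hs : ∀ b, hdeg b = i → P (Finsupp.single b 1))
    {f} (hf : f ∈ homologicalPart k σ hdeg i) : P f := by
  rw [← Finsupp.sum_single f, Finsupp.sum]
  refine Finset.sum_induction _ P hadd h0 fun b hb => ?_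
  rw [← mul_one (f b), ← Finsupp.smul_single']
  exact hsmul _ _ (hs b (mem_homologicalPart.1 hf b (Finsupp.mem_support_iff.1 hb)))

/-- A preimage under a homogenized map can be found strand by strand. -/
lemma exists_homogenize_eq {T : (B →₀ k) →ₗ[k] (B →₀ k)} (hT : Filtered mdeg T) (j : ℕ)
    (f : B →₀ MvPolynomial σ k)
    (h : ∀ a, ∃ w ∈ scalarPart hdeg k j, BoundedBy mdeg a w ∧ T w = strand mdeg a f) :
    ∃ g ∈ homologicalPart k σ hdeg j, homogenize mdeg T g = f := by
  classical
  choose w hw hwb hwT using h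
  -- Preimages are chosen in all multidegrees, but only finitely many strands of `f` are nonzero, so
  -- a finite sum suffices.
  obtain ⟨A, hA⟩ := exists_finset_strand_eq_zero mdeg f
  refine ⟨∑ a ∈ A, homog mdeg a (w a),
    Submodule.sum_mem _ fun a _ => homog_mem_homologicalPart (hw a) a, ?_⟩
  refine strand_ext (mdeg := mdeg) fun a => ?_
  rw [strand_homogenize hT, map_sum,
    Finset.sum_congr rfl fun a' _ => strand_homog mdeg a a' (hwb a'), Finset.sum_ite_eq]
  split_ifs with ha
  · exact hwT a
  · rw [map_zero, hA a ha]

end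

end Strands

/-! ### The lcm lattice -/

section Lattice

variable {k σ : Type*} [Field k] {I : Ideal (MvPolynomial σ k)}

lemma zero_mem_lcmLattice : (0 : σ →₀ ℕ) ∈ lcmLattice I :=
  ⟨∅, by simp, rfl⟩

lemma sup_mem_lcmLattice {a b : σ →₀ ℕ} (ha : a ∈ lcmLattice I) (hb : b ∈ lcmLattice I) :
    a ⊔ b ∈ lcmLattice I := by
  classical
  obtain ⟨V, hV, rfl⟩ := ha
  obtain ⟨W, hW, rfl⟩ := hb
  exact ⟨V ∪ W, by simp [hV, hW], Finset.sup_union.symm⟩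

lemma mem_lcmLattice_of_mem_minimalGenerators {a : σ →₀ ℕ} (ha : a ∈ minimalGenerators I) :
    a ∈ lcmLattice I :=
  ⟨{a}, by simpa using ha, by simp⟩

lemma monomial_mem_of_le {a b : σ →₀ ℕ} (h : a ≤ b) (ha : monomial a (1 : k) ∈ I) :
    monomial b (1 : k) ∈ I := by
  have := I.mul_mem_left (monomial (b - a) 1) ha
  rwa [monomial_mul, tsub_add_cancel_of_le h, one_mul] at this

lemma exists_minimalGenerators_le [Finite σ] {m : σ →₀ ℕ} (hm : monomial m (1 : k) ∈ I) :
    ∃ g ∈ minimalGenerators I, g ≤ m := by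
  obtain ⟨g, hgm, hg⟩ := exists_minimal_le_of_wellFoundedLT
    (fun b => monomial b (1 : k) ∈ I) m hm
  exact ⟨g, hg, hgm⟩

lemma monomial_mem_of_mem_lcmLattice {m : σ →₀ ℕ} (hm : m ∈ lcmLattice I) (h0 : m ≠ 0) :
    monomial m (1 : k) ∈ I := by
  obtain ⟨W, hW, rfl⟩ := hm
  obtain rfl | ⟨g, hg⟩ := W.eq_empty_or_nonempty
  · exact absurd rfl h0
  · exact monomial_mem_of_le (Finset.le_sup (f := id) hg) (hW hg).1

/-- The elements of the lcm lattice dividing a monomial `m` have a greatest element. -/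
lemma exists_greatest_lcmLattice_le [Finite σ] (I : Ideal (MvPolynomial σ k)) (m : σ →₀ ℕ) :
    ∃ n ∈ lcmLattice I, n ≤ m ∧ ∀ l ∈ lcmLattice I, l ≤ m → l ≤ n := by
  classical
  -- The witness is the lcm of all minimal generators dividing `x^m`.
  refine ⟨((Finset.Iic m).filter (· ∈ minimalGenerators I)).sup id, ⟨_, ?_, rfl⟩, ?_, ?_⟩
  · intro g hg
    exact (Finset.mem_filter.1 hg).2
  · exact Finset.sup_le fun g hg => Finset.mem_Iic.1 (Finset.mem_filter.1 hg).1
  · rintro _ ⟨W, hW, rfl⟩ h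
    exact Finset.sup_mono fun g hg =>
      Finset.mem_filter.2 ⟨Finset.mem_Iic.2 ((Finset.le_sup (f := id) hg).trans h), hW hg⟩

/-- If `n = 0`, the only generator that could divide `x^m` is `1`, which properness excludes. -/
lemma monomial_mem_iff_of_greatest [Finite σ] (hI : I ≠ ⊤) {m n : σ →₀ ℕ}
    (hn : n ∈ lcmLattice I) (hnm : n ≤ m) (hmax : ∀ l ∈ lcmLattice I, l ≤ m → l ≤ n) :
    monomial m (1 : k) ∈ I ↔ n ≠ 0 := by
  constructor
  · rintro h rfl
    obtain ⟨g, hg, hgm⟩ := exists_minimalGenerators_le h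
    have h0 := hmax g (mem_lcmLattice_of_mem_minimalGenerators hg) hgm
    rw [nonpos_iff_eq_zero] at h0
    subst h0
    exact hI ((Ideal.eq_top_iff_one I).2 hg.1)
  · exact fun h => monomial_mem_of_le hnm (monomial_mem_of_mem_lcmLattice hn h)

lemma IsSquarefreeMonomialIdeal.apply_le_one (hI : IsSquarefreeMonomialIdeal I) {m : σ →₀ ℕ}
    (hm : m ∈ lcmLattice I) (i : σ) : m i ≤ 1 := by
  classical
  obtain ⟨A, hA, rfl⟩ := hI
  obtain ⟨W, hW, rfl⟩ := hm
  refine Finset.sup_induction (p := fun m : σ →₀ ℕ => m i ≤ 1) (Nat.zero_le 1) ?_ ?_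
  · intro a ha b hb
    exact sup_le ha hb
  · intro g hg
    have hmin := hW hg
    -- Some squarefree `x^a` in `I` divides the minimal generator `x^g`; minimality forces `g ≤ a`.
    obtain ⟨a, ha, hag⟩ := mem_ideal_span_monomial_image.1 hmin.1 g (by simp)
    exact (hmin.2 (Ideal.subset_span ⟨a, ha, rfl⟩) hag i).trans (hA a ha i)

/-- The one use of squarefreeness: `m i ≤ 1`, and if `a i + b i ≥ 1` then already one of the two is
at least `1`. -/
lemma IsSquarefreeMonomialIdeal.le_sup_of_le_add (hI : IsSquarefreeMonomialIdeal I)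
    {m a b : σ →₀ ℕ} (hm : m ∈ lcmLattice I) (h : m ≤ a + b) : m ≤ a ⊔ b := by
  intro i
  have h1 := hI.apply_le_one hm i
  have h2 := h i
  rw [Finsupp.add_apply] at h2
  rw [Finsupp.sup_apply]
  change _ ≤ max _ _
  omega

end Lattice

/-! ### Minimality -/

section Minimality

variable {k σ B : Type*} [Field k]

lemma mem_idealOfVars_iff {p : MvPolynomial σ k} : p ∈ idealOfVars σ k ↔ coeff 0 p = 0 := by
  rw [← pow_one (idealOfVars σ k), mem_pow_idealOfVars_iff']
  simp [Finsupp.degree_eq_zero_iff]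

lemma mem_smul_top_iff {J : Ideal (MvPolynomial σ k)} {f : B →₀ MvPolynomial σ k} :
    f ∈ J • (⊤ : Submodule (MvPolynomial σ k) (B →₀ MvPolynomial σ k)) ↔ ∀ b, f b ∈ J := by
  constructor
  · intro hf b
    have := Submodule.mem_map_of_mem (f := Finsupp.lapply (R := MvPolynomial σ k) b) hf
    rw [Submodule.map_smul''] at this
    simpa using Submodule.smul_mono le_rfl le_top this
  · intro h
    rw [← Finsupp.sum_single f, Finsupp.sum]
    refine Submodule.sum_mem _ fun b _ => ?_
    rw [← mul_one (f b), ← Finsupp.smul_single']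
    exact Submodule.smul_mem_smul (h b) trivial

lemma range_le_idealOfVars_smul_top_iff
    (G : (B →₀ MvPolynomial σ k) →ₗ[MvPolynomial σ k] (B →₀ MvPolynomial σ k)) :
    LinearMap.range G ≤
      idealOfVars σ k • (⊤ : Submodule (MvPolynomial σ k) (B →₀ MvPolynomial σ k)) ↔
    ∀ b b', coeff 0 (G (Finsupp.single b 1) b') = 0 := by
  constructor
  · intro h b b'
    exact mem_idealOfVars_iff.1 (mem_smul_top_iff.1 (h (LinearMap.mem_range_self G _)) b')
  · rintro h _ ⟨f, rfl⟩
    rw [← Finsupp.sum_single f, Finsupp.sum, map_sum]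
    refine Submodule.sum_mem _ fun b _ => ?_
    rw [← mul_one (f b), ← Finsupp.smul_single', map_smul]
    exact Submodule.smul_mem _ _ (mem_smul_top_iff.2 fun b' => mem_idealOfVars_iff.2 (h b b'))

end Minimality

/-! ### Strands of a minimal free resolution -/

namespace MinimalFreeResolution

variable {k σ : Type*} [Field k] {I : Ideal (MvPolynomial σ k)} (F : MinimalFreeResolution I)

/-- The differential after setting all variables to `1`. -/
def scalarD : (F.B →₀ k) →ₗ[k] (F.B →₀ k) := scalarize F.d

lemma filtered_scalarD : Filtered F.mdeg F.scalarD := filtered_scalarize F.d_multidegree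

lemma homogenize_scalarD : homogenize F.mdeg F.scalarD = F.d :=
  homogenize_scalarize F.d_multidegree

lemma strand_d (a : σ →₀ ℕ) (f : F.B →₀ MvPolynomial σ k) :
    strand F.mdeg a (F.d f) = F.scalarD (strand F.mdeg a f) := by
  rw [← F.homogenize_scalarD, strand_homogenize F.filtered_scalarD]

lemma dehom_d (f : F.B →₀ MvPolynomial σ k) : dehom (F.d f) = F.scalarD (dehom f) :=
  dehom_map F.d f

/-- The multidegree `0` is arbitrary: `dehom` ignores exponents, so truncation does no harm here or
in the next lemmas. -/
lemma dehom_homog_surjective (v : F.B →₀ k) : ∃ f : F.B →₀ MvPolynomial σ k, dehom f = v :=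
  ⟨homog F.mdeg 0 v, dehom_homog 0 v⟩

lemma scalarD_scalarD (v : F.B →₀ k) : F.scalarD (F.scalarD v) = 0 := by
  obtain ⟨f, rfl⟩ := F.dehom_homog_surjective v
  rw [← dehom_d, ← dehom_d, F.d_comp_d, map_zero]

lemma scalarD_mem {i : ℕ} {v : F.B →₀ k} (hv : v ∈ scalarPart F.hdeg k (i + 1)) :
    F.scalarD v ∈ scalarPart F.hdeg k i := by
  rw [← dehom_homog (mdeg := F.mdeg) 0 v, ← dehom_d]
  exact dehom_mem_scalarPart (F.d_mem i _ (homog_mem_homologicalPart hv 0))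

lemma scalarD_zero {v : F.B →₀ k} (hv : v ∈ scalarPart F.hdeg k 0) : F.scalarD v = 0 := by
  rw [← dehom_homog (mdeg := F.mdeg) 0 v, ← dehom_d,
    F.d_zero _ (homog_mem_homologicalPart hv 0), map_zero]

lemma d_homog {m : σ →₀ ℕ} {v : F.B →₀ k} (hv : BoundedBy F.mdeg m v) :
    F.d (homog F.mdeg m v) = homog F.mdeg m (F.scalarD v) := by
  have h := F.d_multidegree _ _ (hasMultidegree_homog hv)
  rw [← h.homog_dehom, dehom_d, dehom_homog]

lemma strand_exact {i : ℕ} {m : σ →₀ ℕ} {v : F.B →₀ k}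
    (hv : v ∈ scalarPart F.hdeg k (i + 1)) (hm : BoundedBy F.mdeg m v) (h0 : F.scalarD v = 0) :
    ∃ w ∈ scalarPart F.hdeg k (i + 2), BoundedBy F.mdeg m w ∧ F.scalarD w = v := by
  classical
  obtain ⟨g, hg, hgv⟩ := F.exact i (homog F.mdeg m v) (homog_mem_homologicalPart hv m) (by
    rw [F.d_homog hm, h0]
    exact Finsupp.ext fun b => by simp)
  refine ⟨strand F.mdeg m g, strand_mem_scalarPart hg m, boundedBy_strand _ _ _, ?_⟩
  rw [← strand_d, hgv, strand_homog _ _ _ hm, if_pos rfl]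

lemma strand_single_root (a : σ →₀ ℕ) (s : MvPolynomial σ k) :
    strand F.mdeg a (Finsupp.single F.root s) = Finsupp.single F.root (coeff a s) := by
  rw [strand_single, F.mdeg_root]
  simp

lemma monomial_mem_iff (m : σ →₀ ℕ) : monomial m (1 : k) ∈ I ↔
    ∃ v ∈ scalarPart F.hdeg k 1, BoundedBy F.mdeg m v ∧
      F.scalarD v = Finsupp.single F.root 1 := by
  classical
  rw [← F.augmentation]
  constructor
  · rintro ⟨f, hf, hd⟩
    refine ⟨strand F.mdeg m f, strand_mem_scalarPart hf m, boundedBy_strand _ _ _, ?_⟩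
    rw [← strand_d, hd, strand_single_root, coeff_monomial, if_pos rfl]
  · rintro ⟨v, hv, hm, hd⟩
    refine ⟨homog F.mdeg m v, homog_mem_homologicalPart hv m, ?_⟩
    rw [F.d_homog hm, hd]
    refine Finsupp.ext fun b => ?_
    by_cases hb : F.root = b
    · subst hb
      simp [F.mdeg_root]
    · simp [hb]

/-- With equal multidegrees the matrix entry of `d` is a constant, and minimality forbids nonzero
constants. -/
lemma scalarD_single_apply_eq_zero {b b' : F.B} (h : F.mdeg b' = F.mdeg b) :
    F.scalarD (Finsupp.single b 1) b' = 0 := by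
  have h1 := (range_le_idealOfVars_smul_top_iff F.d).1 F.minimal b b'
  rw [← F.homogenize_scalarD, homogenize_single, homog_apply, h, tsub_self] at h1
  simpa using h1

/-- A basis element contributing at `b'` has multidegree at least `mdeg b'`, hence equal to it,
which minimality excludes. -/
lemma scalarD_apply_eq_zero {b' : F.B} {v : F.B →₀ k} (hv : BoundedBy F.mdeg (F.mdeg b') v) :
    F.scalarD v b' = 0 := by
  rw [← Finsupp.sum_single v, Finsupp.sum, map_sum, Finsupp.finsetSum_apply]
  refine Finset.sum_eq_zero fun b hb => ?_
  rw [← mul_one (v b), ← Finsupp.smul_single', map_smul, Finsupp.smul_apply]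
  by_contra h
  have h1 : F.scalarD (Finsupp.single b 1) b' ≠ 0 := fun h0 => h (by rw [h0, smul_zero])
  have h2 := hv b (Finsupp.mem_support_iff.1 hb)
  exact h1 (F.scalarD_single_apply_eq_zero (le_antisymm (F.filtered_scalarD b b' h1) h2))

/-- If `1 ∈ I`, the root would be a boundary within its own multidegree. -/
lemma ne_top (F : MinimalFreeResolution I) : I ≠ ⊤ := by
  intro h
  obtain ⟨v, -, hv, hd⟩ := (F.monomial_mem_iff 0).1 (by rw [h]; trivial)
  have := F.scalarD_apply_eq_zero (b' := F.root) (by rwa [F.mdeg_root])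
  rw [hd] at this
  simp at this

/-- The multidegrees occurring in the minimal free resolution lie in the lcm lattice. -/
lemma mdeg_mem_lcmLattice [Finite σ] (b : F.B) : F.mdeg b ∈ lcmLattice I := by
  classical
  suffices H : ∀ m b, F.mdeg b = m → m ∈ lcmLattice I from H _ b rfl
  intro m
  induction m using WellFoundedLT.induction with
  | ind m ih =>
  rintro b rfl
  by_contra hb
  -- Multidegrees below `mdeg b` are in the lattice by induction, hence at most `n`. So the boundary
  -- of `b` lives in strand `n`, where it also bounds some `z` that avoids `b`.
  obtain ⟨n, hn, hnm, hmax⟩ := exists_greatest_lcmLattice_le I (F.mdeg b)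
  have hlt : ∀ b', F.mdeg b' < F.mdeg b → F.mdeg b' ≤ n := fun b' h =>
    hmax _ (ih _ h b' rfl) h.le
  have hbd : BoundedBy F.mdeg (F.mdeg b) (Finsupp.single b (1 : k)) := by
    intro b' hb'
    by_cases h : b = b'
    · rw [h]
    · simp [h] at hb'
  -- It suffices to bound `b` by a cycle that avoids `b`.
  have key : ∀ i, F.hdeg b = i + 1 → ∀ z ∈ scalarPart F.hdeg k (i + 1),
      BoundedBy F.mdeg n z → F.scalarD z = F.scalarD (Finsupp.single b 1) → False := by
    intro i hi z hz hzn hd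
    have hzb : z b = 0 := by
      by_contra h
      exact hb (le_antisymm hnm (hzn b h) ▸ hn)
    have hmem : Finsupp.single b (1 : k) - z ∈ scalarPart F.hdeg k (i + 1) :=
      Submodule.sub_mem _ (hi ▸ single_mem_scalarPart b 1) hz
    have hbound : BoundedBy F.mdeg (F.mdeg b) (Finsupp.single b (1 : k) - z) := by
      intro b' h
      by_cases h' : z b' = 0
      · exact hbd b' (by simpa [h'] using h)
      · exact (hzn b' h').trans hnm
    -- The cycle `b - z` has coefficient `1` at `b` but is a boundary within strand `mdeg b`,
    -- contrary to minimality.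
    obtain ⟨w, -, hw, hwd⟩ := F.strand_exact hmem hbound (by rw [map_sub, hd, sub_self])
    have := F.scalarD_apply_eq_zero hw
    rw [hwd] at this
    simp [hzb] at this
  have hbn : BoundedBy F.mdeg n (F.scalarD (Finsupp.single b 1)) := by
    intro b' h
    refine hlt b' (lt_of_le_of_ne (F.filtered_scalarD b b' h) fun h' => ?_)
    exact h (F.scalarD_single_apply_eq_zero h')
  have hself : Finsupp.single b (1 : k) ∈ scalarPart F.hdeg k (F.hdeg b) :=
    single_mem_scalarPart b 1
  -- Exactness yields `z` only when the boundary of `b` has positive homological degree; degree `1`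
  -- needs the augmentation instead.
  match hi : F.hdeg b with
  | 0 =>
    rw [(F.hdeg_eq_zero_iff b).1 hi, F.mdeg_root] at hb
    exact hb zero_mem_lcmLattice
  | i + 2 =>
    rw [hi] at hself
    obtain ⟨z, hz, hzn, hzd⟩ := F.strand_exact (i := i)
      (F.scalarD_mem hself) hbn (F.scalarD_scalarD _)
    exact key (i + 1) hi z hz hzn hzd
  | 1 =>
    rw [hi] at hself
    have hmem : F.scalarD (Finsupp.single b 1) ∈ scalarPart F.hdeg k 0 :=
      F.scalarD_mem hself
    have hroot : F.scalarD (Finsupp.single b 1) =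
        Finsupp.single F.root (F.scalarD (Finsupp.single b 1) F.root) := by
      ext b'
      by_cases h : F.root = b'
      · rw [← h, Finsupp.single_eq_same]
      · rw [Finsupp.single_apply, if_neg h]
        by_contra h'
        exact h ((F.hdeg_eq_zero_iff b').1 (mem_scalarPart.1 hmem b' h')).symm
    set r := F.scalarD (Finsupp.single b 1) F.root with hr
    by_cases h0 : r = 0
    · refine key 0 hi 0 (Submodule.zero_mem _) (fun b' h => absurd rfl h) ?_
      rw [map_zero, hroot, h0, Finsupp.single_zero]
    · have hI : monomial (F.mdeg b) (1 : k) ∈ I := by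
        refine (F.monomial_mem_iff _).2 ⟨r⁻¹ • Finsupp.single b 1,
          Submodule.smul_mem _ _ hself, ?_, ?_⟩
        · intro b' h
          exact hbd b' (right_ne_zero_of_mul (a := r⁻¹) h)
        · rw [map_smul, hroot, Finsupp.smul_single', inv_mul_cancel₀ h0]
      -- A nonzero `r` puts `x^(mdeg b)` in `I`, so `n ≠ 0` and `x^n ∈ I`; strand `n` thus already
      -- reaches the root.
      have hnI := monomial_mem_of_mem_lcmLattice hn
        ((monomial_mem_iff_of_greatest F.ne_top hn hnm hmax).1 hI)
      obtain ⟨z, hz, hzn, hzd⟩ := (F.monomial_mem_iff _).1 hnI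
      refine key 0 hi (r • z) (Submodule.smul_mem _ _ hz) ?_ ?_
      · intro b' h
        exact hzn b' (right_ne_zero_of_mul (by simpa using h))
      · rw [map_smul, hzd, hroot, Finsupp.smul_single', mul_one]

end MinimalFreeResolution

lemma mem_homologicalPart_of_strand {k σ : Type*} [Field k] {B : Type*}
    {hdeg : B → ℕ} {mdeg : B → σ →₀ ℕ} {i : ℕ}
    {f : B →₀ MvPolynomial σ k}
    (hf : ∀ a, strand mdeg a f ∈ scalarPart hdeg k i) :
    f ∈ homologicalPart k σ hdeg i := by
  rw [mem_homologicalPart]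
  intro b hb
  obtain ⟨c, hc⟩ := ne_zero_iff.1 hb
  exact mem_scalarPart.1 (hf (mdeg b + c)) b (by rwa [strand_apply_add])

/-! ### Relabeling a minimal free resolution -/

namespace MinimalFreeResolution

variable {k σ τ : Type*} [Field k] {I : Ideal (MvPolynomial σ k)}

/-- A relabeling of the multidegrees of a minimal free resolution of `S/I` whose strands are
strands of the original resolution. -/
structure IsRelabeling (F : MinimalFreeResolution I) (I' : Ideal (MvPolynomial τ k))
    (mdeg' : F.B → τ →₀ ℕ) : Prop where
  -- `le_of_le` lets the old scalars homogenize, `eq_of_eq` preserves minimality, and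
  -- `exists_strand` gives exactness and the augmentation.
  isMonomialIdeal : IsMonomialIdeal I'
  root : mdeg' F.root = 0
  le_of_le : ∀ b b', F.mdeg b ≤ F.mdeg b' → mdeg' b ≤ mdeg' b'
  eq_of_eq : ∀ b b', mdeg' b = mdeg' b' → F.mdeg b = F.mdeg b'
  exists_strand : ∀ m : τ →₀ ℕ, ∃ n : σ →₀ ℕ, (∀ b, mdeg' b ≤ m ↔ F.mdeg b ≤ n) ∧
    (monomial m (1 : k) ∈ I' ↔ monomial n (1 : k) ∈ I)

namespace IsRelabeling

variable {F : MinimalFreeResolution I} {I' : Ideal (MvPolynomial τ k)} {mdeg' : F.B → τ →₀ ℕ}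
  (h : F.IsRelabeling I' mdeg')

include h

lemma filtered : Filtered mdeg' F.scalarD :=
  fun b b' hb => h.le_of_le b' b (F.filtered_scalarD b b' hb)

lemma strand_exact {i : ℕ} {m : τ →₀ ℕ} {v : F.B →₀ k}
    (hv : v ∈ scalarPart F.hdeg k (i + 1)) (hm : BoundedBy mdeg' m v) (h0 : F.scalarD v = 0) :
    ∃ w ∈ scalarPart F.hdeg k (i + 2), BoundedBy mdeg' m w ∧ F.scalarD w = v := by
  obtain ⟨n, hn, -⟩ := h.exists_strand m
  obtain ⟨w, hw, hwn, hd⟩ := F.strand_exact hv (fun b hb => (hn b).1 (hm b hb)) h0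
  exact ⟨w, hw, fun b hb => (hn b).2 (hwn b hb), hd⟩

lemma monomial_mem_iff (m : τ →₀ ℕ) : monomial m (1 : k) ∈ I' ↔
    ∃ v ∈ scalarPart F.hdeg k 1, BoundedBy mdeg' m v ∧
      F.scalarD v = Finsupp.single F.root 1 := by
  obtain ⟨n, hn, hI⟩ := h.exists_strand m
  simp only [hI, F.monomial_mem_iff, BoundedBy, hn]

lemma strand_single_root (a : τ →₀ ℕ) (s : MvPolynomial τ k) :
    strand mdeg' a (Finsupp.single F.root s) = Finsupp.single F.root (coeff a s) := by
  rw [strand_single, h.root]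
  simp

/-- Reduces the augmentation to monomials, the only elements `exists_strand` speaks of. -/
lemma mem_iff {s : MvPolynomial τ k} : s ∈ I' ↔ ∀ a, coeff a s ≠ 0 → monomial a (1 : k) ∈ I' := by
  obtain ⟨A, rfl⟩ := h.isMonomialIdeal
  rw [mem_ideal_span_monomial_image]
  refine forall_congr' fun a => ?_
  rw [mem_support_iff]
  refine imp_congr_right fun _ => ?_
  rw [mem_ideal_span_monomial_image]
  classical
  simp [coeff_monomial]

lemma augmentation (s : MvPolynomial τ k) :
    (∃ f ∈ homologicalPart k τ F.hdeg 1, homogenize mdeg' F.scalarD f = Finsupp.single F.root s) ↔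
      s ∈ I' := by
  constructor
  · rintro ⟨f, hf, hd⟩
    refine h.mem_iff.2 fun a ha => (h.monomial_mem_iff a).2
      ⟨(coeff a s)⁻¹ • strand mdeg' a f, Submodule.smul_mem _ _ (strand_mem_scalarPart hf a),
        fun b hb => boundedBy_strand mdeg' a f b (right_ne_zero_of_mul (by simpa using hb)), ?_⟩
    rw [map_smul, ← strand_homogenize h.filtered, hd, h.strand_single_root, Finsupp.smul_single',
      inv_mul_cancel₀ ha]
  · intro hs
    refine exists_homogenize_eq h.filtered 1 _ fun a => ?_
    rw [h.strand_single_root]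
    by_cases ha : coeff a s = 0
    · exact ⟨0, Submodule.zero_mem _, fun b hb => absurd rfl hb, by simp [ha]⟩
    · obtain ⟨v, hv, hva, hd⟩ := (h.monomial_mem_iff a).1 (h.mem_iff.1 hs a ha)
      refine ⟨coeff a s • v, Submodule.smul_mem _ _ hv,
        fun b hb => hva b (right_ne_zero_of_mul (by simpa using hb)), ?_⟩
      rw [map_smul, hd, Finsupp.smul_single', mul_one]

/-- The relabeled minimal free resolution. -/
def relabel : MinimalFreeResolution I' where
  B := F.B
  hdeg := F.hdeg
  mdeg := mdeg'
  finite_rank := F.finite_rank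
  root := F.root
  hdeg_eq_zero_iff := F.hdeg_eq_zero_iff
  mdeg_root := h.root
  d := homogenize mdeg' F.scalarD
  d_mem i f hf := mem_homologicalPart_of_strand (mdeg := mdeg') fun a => by
    rw [strand_homogenize h.filtered]
    exact F.scalarD_mem (strand_mem_scalarPart hf a)
  d_zero f hf := strand_ext (mdeg := mdeg') fun a => by
    rw [strand_homogenize h.filtered, F.scalarD_zero (strand_mem_scalarPart hf a), map_zero]
  d_multidegree f a hf := hf.homogenize h.filtered
  d_comp_d f := strand_ext (mdeg := mdeg') fun a => by
    rw [strand_homogenize h.filtered, strand_homogenize h.filtered, F.scalarD_scalarD, map_zero]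
  exact i f hf hd := exists_homogenize_eq h.filtered (i + 2) f fun a =>
    h.strand_exact (strand_mem_scalarPart hf a) (boundedBy_strand mdeg' a f) (by
      rw [← strand_homogenize h.filtered, hd, map_zero])
  augmentation := h.augmentation
  minimal := (range_le_idealOfVars_smul_top_iff _).2 fun b b' => by
    classical
    rw [homogenize_single, homog_apply, coeff_monomial]
    split_ifs with h0
    -- Truncated difference `0` only means `mdeg' b ≤ mdeg' b'`; a nonzero scalar gives the reverse
    -- inequality by filteredness.
    · by_contra hb
      refine hb (F.scalarD_single_apply_eq_zero (h.eq_of_eq _ _ (le_antisymm ?_ ?_)))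
      · exact h.filtered b b' hb
      · exact tsub_eq_zero_iff_le.1 h0
    · rfl

end IsRelabeling

end MinimalFreeResolution

/-! ### Relabeling products -/

section Products

variable {k σ B : Type*} [Field k]

/-- The scalar bilinear map obtained from a bilinear map by setting all variables to `1`. -/
def scalarizeMul (mul : (B →₀ MvPolynomial σ k) →ₗ[MvPolynomial σ k]
      (B →₀ MvPolynomial σ k) →ₗ[MvPolynomial σ k] (B →₀ MvPolynomial σ k)) :
    (B →₀ k) →ₗ[k] (B →₀ k) →ₗ[k] (B →₀ k) :=
  Finsupp.linearCombination k fun b => scalarize (mul (Finsupp.single b 1))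

lemma dehom_mul (mul : (B →₀ MvPolynomial σ k) →ₗ[MvPolynomial σ k]
      (B →₀ MvPolynomial σ k) →ₗ[MvPolynomial σ k] (B →₀ MvPolynomial σ k)) (f g) :
    dehom (mul f g) = scalarizeMul mul (dehom f) (dehom g) := by
  induction f using induction_monomial_smul_single with
  | h0 => simp
  | hadd f g hf hg => simp [hf, hg]
  | hs b c r =>
    rw [map_smul, LinearMap.smul_apply, dehom_smul, dehom_smul, map_smul, LinearMap.smul_apply,
      dehom_single, map_one, dehom_map]
    simp [scalarizeMul]

variable (mdeg : B → σ →₀ ℕ)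

/-- The multigraded bilinear map with the scalar coefficients of `μ`. -/
def homogenizeMul (μ : (B →₀ k) →ₗ[k] (B →₀ k) →ₗ[k] (B →₀ k)) :
    (B →₀ MvPolynomial σ k) →ₗ[MvPolynomial σ k]
      (B →₀ MvPolynomial σ k) →ₗ[MvPolynomial σ k] (B →₀ MvPolynomial σ k) :=
  Finsupp.linearCombination _ fun a => Finsupp.linearCombination _ fun b =>
    homog mdeg (mdeg a + mdeg b) (μ (Finsupp.single a 1) (Finsupp.single b 1))

variable {mdeg} {μ : (B →₀ k) →ₗ[k] (B →₀ k) →ₗ[k] (B →₀ k)}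

lemma homogenizeMul_single (a b : B) :
    homogenizeMul (σ := σ) mdeg μ (Finsupp.single a 1) (Finsupp.single b 1) =
      homog mdeg (mdeg a + mdeg b) (μ (Finsupp.single a 1) (Finsupp.single b 1)) := by
  simp [homogenizeMul]

lemma dehom_homogenizeMul (f g : B →₀ MvPolynomial σ k) :
    dehom (homogenizeMul mdeg μ f g) = μ (dehom f) (dehom g) := by
  induction f using induction_monomial_smul_single with
  | h0 => simp
  | hadd f g hf hg => simp [hf, hg]
  | hs a c r =>
    induction g using induction_monomial_smul_single with
    | h0 => simp
    | hadd f g hf hg => simp only [map_add, hf, hg]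
    | hs b c' r' =>
      simp only [map_smul, LinearMap.smul_apply, dehom_smul, homogenizeMul_single, dehom_homog,
        dehom_single, map_one]

lemma HasMultidegree.homogenizeMul
    (hμ : ∀ a b, BoundedBy mdeg (mdeg a + mdeg b) (μ (Finsupp.single a 1) (Finsupp.single b 1)))
    {f g : B →₀ MvPolynomial σ k} {a b : σ →₀ ℕ} (hf : HasMultidegree mdeg f a)
    (hg : HasMultidegree mdeg g b) :
    HasMultidegree mdeg (homogenizeMul mdeg μ f g) (a + b) := by
  refine HasMultidegree.induction
    (P := fun f => HasMultidegree mdeg (MonomialDGA.homogenizeMul mdeg μ f g) (a + b)) ?_ ?_ ?_ hf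
  · rw [map_zero, LinearMap.zero_apply]
    exact hasMultidegree_zero _
  · intro f f' hf hf'
    rw [map_add, LinearMap.add_apply]
    exact hf.add hf'
  rintro b₁ c r rfl
  refine HasMultidegree.induction (P := fun g => HasMultidegree mdeg
    (MonomialDGA.homogenizeMul mdeg μ (monomial c r • Finsupp.single b₁ 1) g) _) ?_ ?_ ?_ hg
  · rw [map_zero]
    exact hasMultidegree_zero _
  · intro f f' hf hf'
    rw [map_add]
    exact hf.add hf'
  rintro b₂ c' r' rfl
  rw [map_smul, map_smul, LinearMap.smul_apply, homogenizeMul_single]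
  have := ((hasMultidegree_homog (hμ b₁ b₂)).monomial_smul c r).monomial_smul c' r'
  convert this using 1
  abel

end Products

/-! ### Transport of a DGA structure along a relabeling. -/

namespace MinimalFreeResolution

variable {k σ τ : Type*} [Field k] {I : Ideal (MvPolynomial σ k)} {F : MinimalFreeResolution I}
  {I' : Ideal (MvPolynomial τ k)} {mdeg' : F.B → τ →₀ ℕ}
  {mul : (F.B →₀ MvPolynomial σ k) →ₗ[MvPolynomial σ k]
      (F.B →₀ MvPolynomial σ k) →ₗ[MvPolynomial σ k] (F.B →₀ MvPolynomial σ k)}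

lemma IsDGA.boundedBy_mul (hmul : F.IsDGA mul) (a b : F.B) :
    BoundedBy F.mdeg (F.mdeg a + F.mdeg b)
      (scalarizeMul mul (Finsupp.single a 1) (Finsupp.single b 1)) := by
  have := (hmul.mul_multidegree _ _ _ _ (hasMultidegree_single a)
    (hasMultidegree_single b)).boundedBy_dehom
  rwa [dehom_mul, dehom_single, dehom_single, map_one] at this

/-- A DGA structure can be relabeled if the multidegrees occurring in products remain bounded by
the sums of the multidegrees of the factors. -/
lemma IsDGA.relabel (hmul : F.IsDGA mul) (h : F.IsRelabeling I' mdeg')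
    (hle : ∀ a b c, F.mdeg c ≤ F.mdeg a + F.mdeg b → mdeg' c ≤ mdeg' a + mdeg' b) :
    h.relabel.IsDGA (homogenizeMul mdeg' (scalarizeMul mul)) := by
  have hbd : ∀ a b, BoundedBy mdeg' (mdeg' a + mdeg' b)
      (scalarizeMul mul (Finsupp.single a 1) (Finsupp.single b 1)) :=
    fun a b c hc => hle a b c (hmul.boundedBy_mul a b c hc)
  have hdeg_mul : ∀ {f g a b}, HasMultidegree mdeg' f a → HasMultidegree mdeg' g b →
      HasMultidegree mdeg' (homogenizeMul mdeg' (scalarizeMul mul) f g) (a + b) :=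
    fun hf hg => hf.homogenizeMul hbd hg
  have hs : ∀ b, HasMultidegree mdeg' (Finsupp.single b (1 : MvPolynomial τ k)) (mdeg' b) :=
    hasMultidegree_single
  -- The bridge between the two polynomial rings: their basis vectors have the same scalars.
  have hlift : ∀ b : F.B, dehom (Finsupp.single b (1 : MvPolynomial τ k)) =
      dehom (Finsupp.single b (1 : MvPolynomial σ k)) := fun b => by
    rw [dehom_single, dehom_single, map_one, map_one]
  have hd : ∀ {f a}, HasMultidegree mdeg' f a →
      HasMultidegree mdeg' (homogenize mdeg' F.scalarD f) a :=
    fun hf => hf.homogenize h.filtered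
  have hpow : ∀ (i : ℕ) (f : F.B →₀ MvPolynomial σ k),
      dehom ((-1 : MvPolynomial σ k) ^ i • f) = (-1 : k) ^ i • dehom f := fun i f => by
    rw [dehom_smul]
    simp
  have hpow' : ∀ (i : ℕ) (f : F.B →₀ MvPolynomial τ k),
      dehom ((-1 : MvPolynomial τ k) ^ i • f) = (-1 : k) ^ i • dehom f := fun i f => by
    rw [dehom_smul]
    simp
  -- Pattern for the identities: linearity reduces to basis elements, `ext_dehom` to scalars, and
  -- there the identity is the dehomogenized axiom for `mul`.
  constructor
  · intro (f : F.B →₀ MvPolynomial τ k)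
    change homogenizeMul mdeg' (scalarizeMul mul) (Finsupp.single F.root 1) f = f
    induction f using induction_monomial_smul_single with
    | h0 => simp
    | hadd f g hf hg => rw [map_add, hf, hg]
    | hs b c r =>
      rw [map_smul]
      congr 1
      refine (hdeg_mul (hs _) (hs b)).ext_dehom (a := mdeg' F.root + mdeg' b) ?_ ?_
      · rw [h.root, zero_add]
        exact hs b
      · rw [dehom_homogenizeMul, hlift, hlift, ← dehom_mul, hmul.one_mul]
  · intro i (f : F.B →₀ MvPolynomial τ k) (hf : f ∈ homologicalPart k τ F.hdeg i)
      (g : F.B →₀ MvPolynomial τ k)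
    change homogenize mdeg' F.scalarD (homogenizeMul mdeg' (scalarizeMul mul) f g) =
      homogenizeMul mdeg' (scalarizeMul mul) (homogenize mdeg' F.scalarD f) g +
      (-1 : MvPolynomial τ k) ^ i •
        homogenizeMul mdeg' (scalarizeMul mul) f (homogenize mdeg' F.scalarD g)
    -- The sign depends on the degree of `f`, so `f` is decomposed within `F_i`, while `g` is
    -- arbitrary.
    refine homologicalPart_induction (P := fun f => homogenize mdeg' F.scalarD
      (homogenizeMul mdeg' (scalarizeMul mul) f g) =
      homogenizeMul mdeg' (scalarizeMul mul) (homogenize mdeg' F.scalarD f) g +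
      (-1 : MvPolynomial τ k) ^ i •
        homogenizeMul mdeg' (scalarizeMul mul) f (homogenize mdeg' F.scalarD g)) ?_ ?_ ?_ ?_ hf
    · simp
    · intro f f' hf hf'
      simp only [map_add, LinearMap.add_apply, hf, hf', smul_add]
      abel
    · intro p f hf
      simp only [map_smul, LinearMap.smul_apply, hf, smul_add]
      rw [smul_comm p]
    · rintro b rfl
      induction g using induction_monomial_smul_single with
      | h0 => simp
      | hadd g g' hg hg' =>
        simp only [map_add, hg, hg', smul_add]
        abel
      | hs b' c r =>
        simp only [map_smul]
        rw [smul_comm _ (monomial c r), ← smul_add]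
        congr 1
        refine (hd (hdeg_mul (hs b) (hs b'))).ext_dehom ((hdeg_mul (hd (hs b)) (hs b')).add
          ((hdeg_mul (hs b) (hd (hs b'))).neg_one_pow_smul _)) ?_
        have key := congrArg dehom (hmul.leibniz _ _ (single_mem_homologicalPart b 1)
          (Finsupp.single b' 1))
        rw [map_add, hpow, dehom_d, dehom_mul, dehom_mul, dehom_mul, dehom_d, dehom_d] at key
        rw [map_add, hpow', dehom_homogenize, dehom_homogenizeMul, dehom_homogenizeMul,
          dehom_homogenizeMul, dehom_homogenize, dehom_homogenize, hlift, hlift]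
        exact key
  · intro i j (f : F.B →₀ MvPolynomial τ k) (hf : f ∈ homologicalPart k τ F.hdeg i)
      (g : F.B →₀ MvPolynomial τ k)
      (hg : g ∈ homologicalPart k τ F.hdeg j)
    change homogenizeMul mdeg' (scalarizeMul mul) f g ∈ homologicalPart k τ F.hdeg (i + j)
    refine homologicalPart_induction (P := fun f => homogenizeMul mdeg' (scalarizeMul mul) f g ∈
      homologicalPart k τ F.hdeg (i + j)) ?_ ?_ ?_ ?_ hf
    · simp
    · intro f f' hf hf'
      rw [map_add]
      exact Submodule.add_mem _ hf hf'
    · intro p f hf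
      rw [map_smul]
      exact Submodule.smul_mem _ p hf
    rintro b rfl
    refine homologicalPart_induction (P := fun g => homogenizeMul mdeg' (scalarizeMul mul)
      (Finsupp.single b 1) g ∈ homologicalPart k τ F.hdeg (F.hdeg b + j)) ?_ ?_ ?_ ?_ hg
    · simp
    · intro f f' hf hf'
      rw [map_add]
      exact Submodule.add_mem _ hf hf'
    · intro p f hf
      rw [map_smul]
      exact Submodule.smul_mem _ p hf
    rintro b' rfl
    rw [homogenizeMul_single]
    refine homog_mem_homologicalPart ?_ _
    have key := dehom_mem_scalarPart (hmul.mul_mem _ _ _ (single_mem_homologicalPart b 1) _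
      (single_mem_homologicalPart b' 1))
    rwa [dehom_mul, dehom_single, dehom_single, map_one] at key
  · exact fun f g a b => hdeg_mul
  · intro i j (f : F.B →₀ MvPolynomial τ k) (hf : f ∈ homologicalPart k τ F.hdeg i)
      (g : F.B →₀ MvPolynomial τ k)
      (hg : g ∈ homologicalPart k τ F.hdeg j)
    change homogenizeMul mdeg' (scalarizeMul mul) f g =
      (-1 : MvPolynomial τ k) ^ (i * j) • homogenizeMul mdeg' (scalarizeMul mul) g f
    refine homologicalPart_induction (P := fun f => homogenizeMul mdeg' (scalarizeMul mul) f g =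
      (-1 : MvPolynomial τ k) ^ (i * j) • homogenizeMul mdeg' (scalarizeMul mul) g f)
      ?_ ?_ ?_ ?_ hf
    · simp
    · intro f f' hf hf'
      simp only [map_add, LinearMap.add_apply, hf, hf', smul_add]
    · intro p f hf
      simp only [map_smul, LinearMap.smul_apply, hf]
      rw [smul_comm]
    rintro b rfl
    refine homologicalPart_induction (P := fun g => homogenizeMul mdeg' (scalarizeMul mul)
      (Finsupp.single b 1) g = (-1 : MvPolynomial τ k) ^ (F.hdeg b * j) •
        homogenizeMul mdeg' (scalarizeMul mul) g (Finsupp.single b 1)) ?_ ?_ ?_ ?_ hg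
    · simp
    · intro f f' hf hf'
      simp only [map_add, LinearMap.add_apply, hf, hf', smul_add]
    · intro p f hf
      simp only [map_smul, LinearMap.smul_apply, hf]
      rw [smul_comm]
    rintro b' rfl
    refine (hdeg_mul (hs b) (hs b')).ext_dehom (HasMultidegree.neg_one_pow_smul ?_ _) ?_
    · rw [add_comm]
      exact hdeg_mul (hs b') (hs b)
    · have key := congrArg dehom (hmul.mul_comm _ _ _ (single_mem_homologicalPart b 1) _
        (single_mem_homologicalPart b' 1))
      rw [hpow, dehom_mul, dehom_mul] at key
      rw [hpow', dehom_homogenizeMul, dehom_homogenizeMul, hlift, hlift]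
      exact key
  · intro (f : F.B →₀ MvPolynomial τ k) (g : F.B →₀ MvPolynomial τ k) (l : F.B →₀ MvPolynomial τ k)
    change homogenizeMul mdeg' (scalarizeMul mul) (homogenizeMul mdeg' (scalarizeMul mul) f g) l =
      homogenizeMul mdeg' (scalarizeMul mul) f (homogenizeMul mdeg' (scalarizeMul mul) g l)
    induction f using induction_monomial_smul_single with
    | h0 => simp
    | hadd f f' hf hf' => simp only [map_add, LinearMap.add_apply, hf, hf']
    | hs b₁ c₁ r₁ =>
    induction g using induction_monomial_smul_single with
    | h0 => simp
    | hadd f f' hf hf' => simp only [map_add, LinearMap.add_apply, hf, hf']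
    | hs b₂ c₂ r₂ =>
    induction l using induction_monomial_smul_single with
    | h0 => simp
    | hadd f f' hf hf' => simp only [map_add, hf, hf']
    | hs b₃ c₃ r₃ =>
    simp only [map_smul, LinearMap.smul_apply]
    congr 3
    refine (hdeg_mul (hdeg_mul (hs b₁) (hs b₂)) (hs b₃)).ext_dehom
      (a := mdeg' b₁ + mdeg' b₂ + mdeg' b₃) ?_ ?_
    · rw [add_assoc]
      exact hdeg_mul (hs b₁) (hdeg_mul (hs b₂) (hs b₃))
    · have key := congrArg dehom (hmul.mul_assoc (Finsupp.single b₁ 1) (Finsupp.single b₂ 1)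
        (Finsupp.single b₃ 1))
      rw [dehom_mul, dehom_mul, dehom_mul, dehom_mul] at key
      rw [dehom_homogenizeMul, dehom_homogenizeMul, dehom_homogenizeMul, dehom_homogenizeMul,
        hlift, hlift, hlift]
      exact key

end MinimalFreeResolution

/-! ### Isomorphic lcm lattices -/

section Isomorphism

variable {k σ τ : Type*} [Field k] {I : Ideal (MvPolynomial σ k)} {I' : Ideal (MvPolynomial τ k)}

lemma lcmLattice_orderIso_zero (e : lcmLattice I ≃o lcmLattice I') :
    (e ⟨0, zero_mem_lcmLattice⟩ : τ →₀ ℕ) = 0 := by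
  refine nonpos_iff_eq_zero.1 ?_
  have h : e ⟨0, zero_mem_lcmLattice⟩ ≤ ⟨0, zero_mem_lcmLattice⟩ := by
    rw [← e.le_symm_apply]
    exact Subtype.coe_le_coe.1 (zero_le (a := (e.symm _ : σ →₀ ℕ)))
  exact h

/-- Lcm lattices are closed under `⊔` of exponent vectors, so the right-hand join is a lattice
element and can be pulled back along `e`. -/
lemma lcmLattice_orderIso_le_sup (e : lcmLattice I ≃o lcmLattice I') {a b c : lcmLattice I}
    (h : (c : σ →₀ ℕ) ≤ (a : σ →₀ ℕ) ⊔ b) : (e c : τ →₀ ℕ) ≤ (e a : τ →₀ ℕ) ⊔ e b := by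
  let j : lcmLattice I' := ⟨(e a : τ →₀ ℕ) ⊔ e b, sup_mem_lcmLattice (e a).2 (e b).2⟩
  have ha : a ≤ e.symm j := e.le_symm_apply.2 (Subtype.coe_le_coe.1 le_sup_left)
  have hb : b ≤ e.symm j := e.le_symm_apply.2 (Subtype.coe_le_coe.1 le_sup_right)
  have hc : c ≤ e.symm j := Subtype.coe_le_coe.1 (h.trans (sup_le ha hb))
  exact e.le_symm_apply.1 hc

/-- An isomorphism of lcm lattices relabels the minimal free resolution of `S/I` to a minimal free
resolution of `S'/I'`. -/
lemma MinimalFreeResolution.isRelabeling_of_orderIso [Finite σ] [Finite τ]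
    (F : MinimalFreeResolution I) (hI' : IsMonomialIdeal I') (hproper : I' ≠ ⊤)
    (e : lcmLattice I ≃o lcmLattice I') :
    F.IsRelabeling I' fun b => e ⟨F.mdeg b, F.mdeg_mem_lcmLattice b⟩ where
  isMonomialIdeal := hI'
  root := by
    simp only [F.mdeg_root]
    exact lcmLattice_orderIso_zero e
  le_of_le b b' h := e.monotone (Subtype.coe_le_coe.1 h)
  eq_of_eq b b' h := congrArg Subtype.val (e.injective (Subtype.ext h))
  exists_strand m := by
    obtain ⟨n, hn, hnm, hmax⟩ := exists_greatest_lcmLattice_le I' m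
    refine ⟨e.symm ⟨n, hn⟩, fun b => ?_, ?_⟩
    · trans e ⟨F.mdeg b, F.mdeg_mem_lcmLattice b⟩ ≤ ⟨n, hn⟩
      · exact ⟨fun h => hmax _ (Subtype.coe_prop _) h, fun h => le_trans h hnm⟩
      · rw [← e.le_symm_apply]
        rfl
    -- Both memberships say that the greatest lattice element below is nonzero, and `e` matches the
    -- bottoms.
    · rw [monomial_mem_iff_of_greatest hproper hn hnm hmax,
        monomial_mem_iff_of_greatest F.ne_top (e.symm ⟨n, hn⟩).2 le_rfl fun _ _ h => h]
      refine not_congr ⟨?_, fun h => ?_⟩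
      · rintro rfl
        exact lcmLattice_orderIso_zero e.symm
      · have h1 : e.symm ⟨n, hn⟩ = ⟨0, zero_mem_lcmLattice⟩ := Subtype.ext h
        have h2 := lcmLattice_orderIso_zero e
        rwa [← h1, e.apply_symm_apply] at h2

end Isomorphism

end MonomialDGA

end

theorem corollary6p7 {k σ τ : Type*} [Field k] [Finite σ] [Finite τ]
    (I : Ideal (MvPolynomial σ k)) (I' : Ideal (MvPolynomial τ k))
    (hI : MonomialDGA.IsSquarefreeMonomialIdeal I) (hI' : MonomialDGA.IsMonomialIdeal I')
    (hproper : I' ≠ ⊤) (hL : MonomialDGA.LcmLatticeIsomorphic I I')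
    (hDGA : MonomialDGA.AdmitsMinimalDGAResolution I) :
    MonomialDGA.AdmitsMinimalDGAResolution I' := by
  obtain ⟨e⟩ := hL
  obtain ⟨F, mul, hmul⟩ := hDGA
  refine ⟨_, _, hmul.relabel (F.isRelabeling_of_orderIso hI' hproper e) fun a b c h => ?_⟩
  -- Sum bound to join bound in `L_I`, across `e`, and back to a sum bound in `L_{I'}`.
  exact (MonomialDGA.lcmLattice_orderIso_le_sup e
    (hI.le_sup_of_le_add (F.mdeg_mem_lcmLattice c) h)).trans
    (sup_le le_self_add le_add_self)
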